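/- For $n\in\mathbb N=\{0,1,2,\dots\}$ let $L_n$ be the oriented knot given by the following plane diagram, read from bottom to top, where the strands at each height are numbered $0,1,2,\dots$ from left to right. Write $\cup_i$ and $\cap_i$ for a local minimum and a local maximum whose ends are in positions $i,i+1$, and $\sigma_i$ (resp. $\sigma_i^{-1}$) for a crossing of the strands in positions $i,i+1$ at which the strand running from the bottom left to the top right is the over-strand (resp. the under-strand). Then $L_n$ is $$\cup_0\,\cup_1\,\cup_2\;(\sigma_0^{-1}\sigma_1^{-1})^3\;(\sigma_2^{-1})^{2n}\;\cup_5\,\sigma_4\,\sigma_6\,\cap_5\,\sigma_3\;\cap_2\,\cap_1\,\cap_0 ,$$ oriented so that the left strand at the first minimum $\cup_0$ points upwards. Thus $(\sigma_0^{-1}\sigma_1^{-1})^3$ is a left-handed full twist on three strands, and $(\sigma_2^{-1})^{2n}$ is a module of $n$ left-handed full twists on two antiparallel strands, whose crossings are positive; up to mirror images $L_0=5_2$, $L_1=9_{45}$ and $L_2=11n_{63}$ in the knot tables. Let $V(K,t)\in\mathbb Z[t^{\pm1/2}]$ be the Jones polynomial of oriented links, normalized by the value $1$ on the unknot and with the skein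 relation $$t\,V(K_+,t)-t^{-1}V(K_-,t)=(t^{1/2}-t^{-1/2})\,V(K_0,t),$$ where $K_+,K_-,K_0$ have diagrams that are identical away from a crossing, at which $K_+$ has a positive (right-handed) crossing, $K_-$ a negative crossing, and $K_0$ the oriented resolution. Then for every $n\ge 0$ $$\frac{\partial^2 V(L_n,e^{h})}{\partial h^2}(0)=-12,\qquad \frac{\partial^3 V(L_n,e^{h})}{\partial h^3}(0)=36n+108 .$$ -/

import Mathlib

namespace KnotDiagram

open scoped LaurentPolynomial

/-- Elementary pieces of an oriented link diagram in the plane that is in general position with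
respect to the height function. A diagram is read from bottom to top; at every regular height it
meets the horizontal line in finitely many strands, numbered `0, 1, 2, …` from left to right.
* `cup i b`: a local minimum, creating two new strands in the positions `i` and `i + 1`; it is
  oriented so that the left one of them points upwards iff `b = true` (and the right one points
  upwards iff `b = false`).
* `cap i`: a local maximum, joining the strands in the positions `i` and `i + 1`.
* `cross i e`: a crossing of the strands in the positions `i` and `i + 1`. If `e = true`, the strand
  that runs from the bottom left to the top right is the over-strand; if `e = false`, it is
  the strand that runs from the bottom right to the top left. -/
inductive Slice : Type
  | cup (i : ℕ) (b : Bool)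
  | cap (i : ℕ)
  | cross (i : ℕ) (e : Bool)

/-- The effect of a slice on the list of directions of the strands (`true` is upwards), or `none`
if the slice does not fit on top of these strands: the positions have to exist, and a cap has to
join an upward strand to a downward one. -/
def Slice.step : Slice → List Bool → Option (List Bool)
  | .cup i b, l => if i ≤ l.length then some (l.take i ++ b :: (!b) :: l.drop i) else none
  | .cap i, l =>
    match l.drop i with
    | a :: b :: r => if a = b then none else some (l.take i ++ r)
    | _ => none
  | .cross i _, l =>
    match l.drop i with
    | a :: b :: r => some (l.take i ++ b :: a :: r)
    | _ => none

/-- The directions of the strands on top of a stack of slices (listed from bottom to top) that is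
put on strands with directions `l`; `none` if the slices do not fit together. -/
def strandsAbove : List Slice → List Bool → Option (List Bool)
  | [], l => some l
  | s :: w, l => (s.step l).bind (strandsAbove w)

/-- A (non-empty) oriented link diagram: a stack of slices that fit together, without strands at
the bottom and at the top. -/
structure LinkDiagram where
  slices : List Slice
  nonempty : slices ≠ []
  closed : strandsAbove slices [] = some []

/-! ### The Jones polynomial -/

/-- The part of a crossingless diagram below a given height: the list `arcs` records for every
strand, from left to right, the name of the arc to which it belongs (so two strands have the same
name iff they are the two ends of one arc), and `circles` is the number of closed circles. -/
structure FlatState where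
  arcs : List ℕ
  circles : ℕ

/-- A name that is not used in the list. -/
def freshName (l : List ℕ) : ℕ := l.foldr max 0 + 1

/-- Put a local minimum on top: a new arc, with both ends in the positions `i` and `i + 1`. -/
def FlatState.cup (i : ℕ) (p : FlatState) : FlatState :=
  ⟨p.arcs.take i ++ freshName p.arcs :: freshName p.arcs :: p.arcs.drop i, p.circles⟩

/-- Put a local maximum on top, joining the strands in the positions `i` and `i + 1`: if these are
the ends of one arc, a circle is closed; otherwise two arcs are united. -/
def FlatState.cap (i : ℕ) (p : FlatState) : FlatState :=
  match p.arcs.drop i with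
  | a :: b :: r =>
    if a = b then ⟨p.arcs.take i ++ r, p.circles + 1⟩
    else ⟨(p.arcs.take i ++ r).map fun x => if x = b then a else x, p.circles⟩
  | _ => p

/-- Whether the strands in the positions `i` and `i + 1` point both upwards or both downwards. -/
def parallelAt (i : ℕ) (l : List Bool) : Bool := l[i]? == l[i + 1]?

/-- Whether the crossing `cross i e` on top of strands with directions `l` is positive
(right-handed). -/
def isPositive (i : ℕ) (e : Bool) (l : List Bool) : Bool := e == parallelAt i l

open LaurentPolynomial in
/-- The weight of the smoothing of a crossing that respects the orientations: `t^(-1/2)` for a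
positive and `t^(1/2)` for a negative crossing. The indeterminate of the Laurent polynomials,
whose powers are `T k`, is `t^(1/2)`. -/
noncomputable def orientedWeight (positive : Bool) : ℤ[T;T⁻¹] := if positive then T (-1) else T 1

open LaurentPolynomial in
/-- The weight of the smoothing of a crossing that does not respect the orientations: `-t^(-1)` for
a positive and `-t` for a negative crossing. -/
noncomputable def disorientedWeight (positive : Bool) : ℤ[T;T⁻¹] :=
  if positive then -T (-2) else -T 2

open LaurentPolynomial in
/-- Kauffman's state sum over all ways to smooth the crossings of a stack of slices put on
strands with directions `l`, where the part below has been smoothed already, with the result `p`.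
A crossing is smoothed either into two vertical strands (which respects the orientations iff the
two strands are parallel) or into a local maximum below a local minimum (which respects the
orientations iff the two strands are antiparallel). Every state contributes the product of the
weights of its smoothings times `(t^(1/2) + t^(-1/2))^(c - 1)`, where `c` is its number of
circles.

With `t^(1/2) = -A^2` this is `(-A^3)^(-w)` times the sum of `A^(a - b) (-A^2 - A^(-2))^(c - 1)`
over the states, where `w` is the writhe and `a` and `b` are the numbers of smoothings
of type `A` and `B`. -/
noncomputable def stateSum : List Slice → List Bool → FlatState → ℤ[T;T⁻¹]
  | [], _, p => (T 1 + T (-1)) ^ (p.circles - 1)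
  | s :: w, l, p =>
    match s.step l with
    | none => 0
    | some l' =>
      match s with
      | .cup i _ => stateSum w l' (p.cup i)
      | .cap i => stateSum w l' (p.cap i)
      | .cross i e =>
        if parallelAt i l then
          orientedWeight (isPositive i e l) * stateSum w l' p +
            disorientedWeight (isPositive i e l) * stateSum w l' ((p.cap i).cup i)
        else
          disorientedWeight (isPositive i e l) * stateSum w l' p +
            orientedWeight (isPositive i e l) * stateSum w l' ((p.cap i).cup i)

/-- The Jones polynomial `V(D)` of an oriented link diagram, a Laurent polynomial in `t^(1/2)`. -/
noncomputable def jones (D : LinkDiagram) : ℤ[T;T⁻¹] := stateSum D.slices [] ⟨[], 0⟩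

/-- The value `V(D, t)` of the Jones polynomial at a real number `t > 0`. -/
noncomputable def jonesAt (D : LinkDiagram) (t : ℝ) (ht : 0 < t) : ℝ :=
  LaurentPolynomial.eval₂ (Int.castRingHom ℝ) (Units.mk0 (√t) (Real.sqrt_pos.2 ht).ne') (jones D)

/-- The diagram of the unknot without crossings. -/
def unknot : LinkDiagram := ⟨[.cup 0 true, .cap 0], by simp, by decide⟩

/-- The slices that replace a crossing of the strands `i` and `i + 1` in its oriented smoothing:
none if these are parallel, and a local maximum below a local minimum otherwise. -/
def orientedSmoothing (i : ℕ) (l : List Bool) : List Slice :=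
  if parallelAt i l then [] else [.cap i, .cup i (l[i + 1]?.getD true)]

/-- Three diagrams that are identical away from one crossing, where `Kp` has a positive crossing,
`Km` a negative crossing, and `K0` is the oriented resolution. -/
def IsSkeinTriple (Kp Km K0 : LinkDiagram) : Prop :=
  ∃ (u w : List Slice) (i : ℕ) (e : Bool) (l : List Bool),
    strandsAbove u [] = some l ∧ isPositive i e l = true ∧
    Kp.slices = u ++ .cross i e :: w ∧ Km.slices = u ++ .cross i (!e) :: w ∧
    K0.slices = u ++ (orientedSmoothing i l ++ w)

/-- Normalization of the Jones polynomial. -/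
theorem jones_unknot : jones unknot = 1 := by
  simp [jones, unknot, stateSum, Slice.step, FlatState.cup, FlatState.cap]

theorem strandsAbove_append (u w : List Slice) (l : List Bool) :
    strandsAbove (u ++ w) l = (strandsAbove u l).bind (strandsAbove w) := by
  induction u generalizing l with
  | nil => rfl
  | cons s u ih =>
    simp only [List.cons_append, strandsAbove]
    cases s.step l <;> simp [ih]

open LaurentPolynomial in
theorem stateSum_skein (w : List Slice) (i : ℕ) (e : Bool) (l l' : List Bool)
    (he : isPositive i e l = true) (hl : (Slice.cross i e).step l = some l')
    (u : List Slice) (l₀ : List Bool) (hu : strandsAbove u l₀ = some l) (p : FlatState) :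
    T 2 * stateSum (u ++ .cross i e :: w) l₀ p - T (-2) * stateSum (u ++ .cross i (!e) :: w) l₀ p =
      (T 1 - T (-1)) * stateSum (u ++ (orientedSmoothing i l ++ w)) l₀ p := by
  induction u generalizing l₀ p with
  | nil =>
    simp only [strandsAbove, Option.some.injEq] at hu
    subst hu
    have he' : isPositive i (!e) l₀ = false := by
      revert he; unfold isPositive; cases e <;> cases parallelAt i l₀ <;> simp
    have hl2 : (Slice.cross i (!e)).step l₀ = some l' := hl
    have e1 : (T 2 * T (-1) : ℤ[T;T⁻¹]) = T 1 := by rw [← T_add]; rfl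
    have e2 : (T 2 * T (-2) : ℤ[T;T⁻¹]) = 1 := by rw [← T_add]; exact T_zero
    have e3 : (T (-2) * T 1 : ℤ[T;T⁻¹]) = T (-1) := by rw [← T_add]; rfl
    simp only [List.nil_append]
    rw [stateSum, stateSum, hl, hl2]
    simp only [he, he', orientedWeight, disorientedWeight, orientedSmoothing]
    obtain ⟨a, b, r, hd⟩ : ∃ a b r, l₀.drop i = a :: b :: r := by
      revert hl
      simp only [Slice.step]
      rcases l₀.drop i with _ | ⟨a, _ | ⟨b, r⟩⟩ <;> simp
    have hlen : i + 2 ≤ l₀.length := by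
      have := congrArg List.length hd
      simp at this; omega
    have ha : l₀[i]? = some a := by
      have : (l₀.drop i)[0]? = some a := by rw [hd]; rfl
      simpa using this
    have hb : l₀[i + 1]? = some b := by
      have : (l₀.drop i)[1]? = some b := by rw [hd]; rfl
      simpa using this
    have hl3 : l' = l₀.take i ++ b :: a :: r := by
      simp only [Slice.step, hd, Option.some.injEq] at hl
      exact hl.symm
    by_cases hp : parallelAt i l₀ = true
    · have hs : l' = l₀ := by
        have hab : a = b := by simpa [parallelAt, ha, hb] using hp
        subst hab
        rw [hl3, ← hd, List.take_append_drop]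
      subst hs
      simp only [hp, if_true, if_false, Bool.false_eq_true, List.nil_append]
      linear_combination (stateSum w l' p) * e1 - (stateSum w l' p) * e3
    · have hab : a ≠ b := by simpa [parallelAt, ha, hb] using hp
      have hba : (!b) = a := by revert hab; cases a <;> cases b <;> simp
      have hlt : (l₀.take i).length = i := by simp; omega
      have hc1 : (Slice.cap i).step l₀ = some (l₀.take i ++ r) := by
        simp [Slice.step, hd, hab]
      have hc2 : (Slice.cup i b).step (l₀.take i ++ r) = some l' := by
        simp only [Slice.step]
        rw [if_pos (by simp; omega), List.take_left' hlt, List.drop_left' hlt, hba, hl3]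
      simp only [hp, if_true, if_false, Bool.false_eq_true, hb, Option.getD_some,
        List.cons_append, List.nil_append]
      rw [stateSum, hc1]
      simp only []
      rw [stateSum, hc2]
      simp only []
      linear_combination (stateSum w l' ((p.cap i).cup i)) * e1 -
        (stateSum w l' ((p.cap i).cup i)) * e3
  | cons s u ih =>
    simp only [strandsAbove] at hu
    rcases hs : s.step l₀ with _ | l₁
    · simp [hs] at hu
    · rw [hs] at hu
      have ih := fun p => ih l₁ hu p
      simp only [List.cons_append]
      rw [stateSum, stateSum, stateSum, hs]
      cases s with
      | cup j b => exact ih _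
      | cap j => exact ih _
      | cross j f =>
        simp only []
        split
        · linear_combination orientedWeight (isPositive j f l₀) * ih p +
            disorientedWeight (isPositive j f l₀) * ih ((p.cap j).cup j)
        · linear_combination disorientedWeight (isPositive j f l₀) * ih p +
            orientedWeight (isPositive j f l₀) * ih ((p.cap j).cup j)

open LaurentPolynomial in
/-- The skein relation `t V(K₊) - t⁻¹ V(K₋) = (t^(1/2) - t^(-1/2)) V(K₀)`. -/
theorem jones_skein {Kp Km K0 : LinkDiagram} (h : IsSkeinTriple Kp Km K0) :
    T 2 * jones Kp - T (-2) * jones Km = (T 1 - T (-1)) * jones K0 := by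
  obtain ⟨u, w, i, e, l, hu, he, h1, h2, h3⟩ := h
  have hc := Kp.closed
  rw [h1, strandsAbove_append, hu] at hc
  rcases hl : (Slice.cross i e).step l with _ | l'
  · simp [strandsAbove, hl] at hc
  rw [jones, jones, jones, h1, h2, h3]
  exact stateSum_skein w i e l l' he hl u [] hu _

/-! ### The knots `L_n` -/

/-- A left-handed full twist of the three strands in the positions `0`, `1`, `2`. -/
def fullLeftTwist : List Slice :=
  [.cross 0 false, .cross 1 false, .cross 0 false, .cross 1 false, .cross 0 false, .cross 1 false]

/-- `n` left-handed full twists of the two (antiparallel) strands in the positions `2` and `3`. -/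
def twistModule (n : ℕ) : List Slice := List.replicate (2 * n) (.cross 2 false)

/-- The slices of the diagram of `L_n`. Three nested minima and maxima close up, in an annulus, a
pattern on three strands (the strands in the positions `0`, `1`, `2`, with directions up, down,
down). The pattern consists of a left-handed full twist of the three strands (the result of
blowing down a `+1`-framed unknot around them), a clasp (the slices from `cup 5` to `cap 5`), one
more crossing, and the module of `n` left-handed full twists on two antiparallel strands. -/
def twistKnotSlices (n : ℕ) : List Slice :=
  [.cup 0 true, .cup 1 false, .cup 2 false] ++ fullLeftTwist ++ twistModule n ++
    [.cup 5 true, .cross 4 true, .cross 6 true, .cap 5, .cross 3 true, .cap 2, .cap 1, .cap 0]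

theorem strandsAbove_twistModule (n : ℕ) (a b c d : Bool) (r : List Bool) :
    strandsAbove (twistModule n) (a :: b :: c :: d :: r) = some (a :: b :: c :: d :: r) := by
  induction n with
  | zero => rfl
  | succ n ih =>
    rw [twistModule, show 2 * (n + 1) = 2 * n + 1 + 1 by ring, List.replicate_succ,
      List.replicate_succ]
    simpa [strandsAbove, Slice.step, twistModule] using ih

/-- The oriented knot `L_n`, for example `L_0 = 5_2`, `L_1 = 9_45` and `L_2 = 11n_63` (up to mirror
images). -/
def L (n : ℕ) : LinkDiagram where
  slices := twistKnotSlices n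
  nonempty := by simp [twistKnotSlices]
  closed := by
    simp only [twistKnotSlices, strandsAbove_append]
    have h : strandsAbove fullLeftTwist [true, false, false, true, true, false] =
        some [true, false, false, true, true, false] := by decide
    have h' : strandsAbove [.cup 0 true, .cup 1 false, .cup 2 false] [] =
        some [true, false, false, true, true, false] := by decide
    simp only [h', h, Option.bind_some, strandsAbove_twistModule]
    decide

end KnotDiagram

/-!
The `2 n` crossings of the twist module all sit on the same two antiparallel strands, so in the
state sum each of them acts as `-t⁻¹ + t^(-1/2) U`, where `U` is the turnback (a maximum below a
minimum). Since `U² = (t^(1/2) + t^(-1/2)) U`, this operator fixes `U`, and two crossings act as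
`t⁻² + (t^(-1/2) - t^(-3/2)) U` (`stateSum_twist`). Hence
`V(L_{n+1}) = t⁻² V(L_n) + (t^(-1/2) - t^(-3/2)) V(M)` (`jones_L_succ`), where `M` is the
two-component link obtained from `L_n` by replacing the whole module by a turnback.

The identity for `U²` needs that a closed circle contributes a factor `t^(1/2) + t^(-1/2)`. As the
state sum is normalized by the exponent `c - 1`, with truncated subtraction, this requires that a
state has another circle besides; that is `stateSum_addCircle`, for which the part of the state
below has to be a genuine system of arcs. It suffices that every name occurs an even number of
times (`FlatState.Fits`).

The two remaining Laurent polynomials `V(L_0)` and `V(M)` have nine crossings each. They are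
computed by evaluating the state sum with lists of integer coefficients (`stateCoeffs`).

Finally, the `k`-th derivative of `t^(m/2)` at `t = e^h`, `h = 0`, is `(m/2)^k`, so the derivatives
in question are moments of the Laurent polynomial (`moment`). Multiplication by `t^(m/2)` acts on
the moments by the binomial formula, and the recursion gives the claim by induction on `n`.
-/

namespace KnotDiagram

open scoped LaurentPolynomial
open LaurentPolynomial

/-! ### Well-formed flat states -/

/-- The flat state with one more closed circle. -/
def FlatState.addCircle (p : FlatState) : FlatState := ⟨p.arcs, p.circles + 1⟩

/-- The flat state has `n` strands, and every name occurs an even number of times among them. This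
is weaker than being a system of arcs, where every name occurs exactly twice or not at all, but it
is preserved by all slices and it implies that the last maximum closes a circle. -/
structure FlatState.Fits (p : FlatState) (n : ℕ) : Prop where
  length_eq : p.arcs.length = n
  even_count : ∀ x, Even (p.arcs.count x)

theorem FlatState.fits_empty (c : ℕ) : FlatState.Fits ⟨[], c⟩ 0 := ⟨rfl, by simp⟩

theorem exists_drop_eq {α : Type*} {l : List α} {i n : ℕ} (hl : l.length = n + 2) (hi : i ≤ n) :
    ∃ a b r, l.drop i = a :: b :: r := by
  have h : (l.drop i).length = n + 2 - i := by simp [hl]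
  rcases hd : l.drop i with _ | ⟨a, _ | ⟨b, r⟩⟩
  · simp [hd] at h; omega
  · simp [hd] at h; omega
  · exact ⟨a, b, r, rfl⟩

/-- The numbers of occurrences after renaming `b` to `a`. -/
theorem count_map_replace {a b : ℕ} (hab : a ≠ b) (l : List ℕ) (x : ℕ) :
    (l.map fun y => if y = b then a else y).count x =
      if x = b then 0 else if x = a then l.count a + l.count b else l.count x := by
  induction l with
  | nil => simp
  | cons y l ih =>
    simp only [List.map_cons, List.count_cons, ih, beq_iff_eq]
    split_ifs <;> omega

theorem FlatState.Fits.cup {p : FlatState} {n i : ℕ} (hp : p.Fits n) (hi : i ≤ n) :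
    (p.cup i).Fits (n + 2) := by
  constructor
  · simp [FlatState.cup, hp.length_eq]
    omega
  · intro x
    have h := hp.even_count x
    rw [← List.take_append_drop i p.arcs, List.count_append] at h
    simp only [FlatState.cup, List.count_append, List.count_cons]
    split_ifs
    · rw [show ∀ m k : ℕ, m + (k + 1 + 1) = m + k + 2 by omega]
      exact h.add even_two
    · simpa using h

theorem FlatState.Fits.cap {p : FlatState} {n i : ℕ} (hp : p.Fits (n + 2)) (hi : i ≤ n) :
    (p.cap i).Fits n := by
  obtain ⟨a, b, r, hd⟩ := exists_drop_eq hp.length_eq hi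
  have hlen : (p.arcs.take i).length + r.length = n := by
    have h1 := congrArg List.length hd
    have h2 := hp.length_eq
    simp at h1 ⊢
    omega
  have hcount : ∀ x, Even ((p.arcs.take i ++ r).count x + ((if b = x then 1 else 0) +
      if a = x then 1 else 0)) := by
    intro x
    have h := hp.even_count x
    rw [← List.take_append_drop i p.arcs, hd] at h
    simpa [List.count_append, List.count_cons, add_assoc] using h
  rw [FlatState.cap, hd]
  by_cases hab : a = b
  · subst hab
    simp only [if_true]
    refine ⟨by simpa using hlen, fun x => ?_⟩
    have h := hcount x
    split_ifs at h
    · simpa [Nat.even_add] using h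
    · simpa using h
  · simp only [hab, if_false]
    refine ⟨by simpa using hlen, fun x => ?_⟩
    have ha := hcount a
    have hb := hcount b
    have hx := hcount x
    rw [count_map_replace hab]
    simp only [hab, Ne.symm hab, if_true, if_false] at ha hb
    split_ifs with h1 h2
    · exact Even.zero
    · rw [zero_add, Nat.even_add_one, Nat.not_even_iff_odd] at ha
      rw [add_zero, Nat.even_add_one, Nat.not_even_iff_odd] at hb
      exact ha.add_odd hb
    · simpa [Ne.symm h1, Ne.symm h2] using hx

/-- After a maximum there are still strands, or there is a closed circle. -/
theorem FlatState.Fits.cap_nonempty {p : FlatState} {n i : ℕ} (hp : p.Fits (n + 2)) (hi : i ≤ n) :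
    (p.cap i).arcs ≠ [] ∨ (p.cap i).circles ≠ 0 := by
  obtain ⟨a, b, r, hd⟩ := exists_drop_eq hp.length_eq hi
  have h := hp.even_count a
  rw [← List.take_append_drop i p.arcs, hd] at h
  rw [FlatState.cap, hd]
  by_cases hab : a = b
  · right
    simp [hab]
  · left
    simp only [hab, if_false, ne_eq, List.map_eq_nil_iff, List.append_eq_nil_iff]
    rintro ⟨h1, h2⟩
    simp [h1, h2, Ne.symm hab] at h

theorem FlatState.cup_arcs_ne_nil (p : FlatState) (i : ℕ) : (p.cup i).arcs ≠ [] := by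
  simp [FlatState.cup]

theorem FlatState.addCircle_cup (p : FlatState) (i : ℕ) :
    p.addCircle.cup i = (p.cup i).addCircle := rfl

theorem FlatState.addCircle_cap (p : FlatState) (i : ℕ) :
    p.addCircle.cap i = (p.cap i).addCircle := by
  simp only [FlatState.cap, FlatState.addCircle]
  rcases p.arcs.drop i with _ | ⟨a, _ | ⟨b, r⟩⟩
  · rfl
  · rfl
  · by_cases hab : a = b <;> simp [hab]

/-- Closing a minimum by a maximum right above it splits off a circle. -/
theorem FlatState.cap_cup (p : FlatState) {i : ℕ} (hi : i ≤ p.arcs.length) :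
    (p.cup i).cap i = p.addCircle := by
  have h : (p.arcs.take i).length = i := by simpa using hi
  simp only [FlatState.cap, FlatState.cup, FlatState.addCircle]
  rw [List.drop_left' h, List.take_left' h]
  simp

theorem length_of_cup {i : ℕ} {b : Bool} {l l' : List Bool} (h : (Slice.cup i b).step l = some l') :
    i ≤ l.length ∧ l'.length = l.length + 2 := by
  simp only [Slice.step] at h
  split_ifs at h with hi
  cases h
  simp
  omega

theorem length_of_cap {i : ℕ} {l l' : List Bool} (h : (Slice.cap i).step l = some l') :
    i ≤ l'.length ∧ l.length = l'.length + 2 := by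
  simp only [Slice.step] at h
  rcases hd : l.drop i with _ | ⟨a, _ | ⟨b, r⟩⟩
  · simp [hd] at h
  · simp [hd] at h
  · have h1 := congrArg List.length hd
    simp only [hd] at h
    split_ifs at h
    cases h
    simp at h1 ⊢
    omega

theorem length_of_cross {i : ℕ} {e : Bool} {l l' : List Bool}
    (h : (Slice.cross i e).step l = some l') :
    l'.length = l.length ∧ ∃ n, i ≤ n ∧ l.length = n + 2 := by
  simp only [Slice.step] at h
  rcases hd : l.drop i with _ | ⟨a, _ | ⟨b, r⟩⟩
  · simp [hd] at h
  · simp [hd] at h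
  · have h1 := congrArg List.length hd
    simp only [hd] at h
    cases h
    simp at h1 ⊢
    exact ⟨by omega, l.length - 2, by omega, by omega⟩

/-! ### The state sum and the twist module -/

/-- A closed circle contributes the factor `t^(1/2) + t^(-1/2)`. The hypothesis `h` guarantees that
the completed states have another circle. -/
theorem stateSum_addCircle (w : List Slice) (l : List Bool) (hw : strandsAbove w l = some [])
    (p : FlatState) (hp : p.Fits l.length) (h : p.arcs ≠ [] ∨ p.circles ≠ 0) :
    stateSum w l p.addCircle = (T 1 + T (-1)) * stateSum w l p := by
  induction w generalizing l p with
  | nil =>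
    simp only [strandsAbove, Option.some.injEq] at hw
    subst hw
    have ha : p.arcs = [] := List.eq_nil_of_length_eq_zero hp.length_eq
    obtain ⟨c, hc⟩ := Nat.exists_eq_succ_of_ne_zero (h.resolve_left (by simp [ha]))
    simp [stateSum, FlatState.addCircle, hc, pow_succ']
  | cons s w ih =>
    simp only [strandsAbove] at hw
    rcases hs : s.step l with _ | l'
    · simp [hs] at hw
    simp only [hs, Option.bind_some] at hw
    rw [stateSum, stateSum, hs]
    cases s with
    | cup i b =>
      obtain ⟨hi, hl⟩ := length_of_cup hs
      simp only [FlatState.addCircle_cup]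
      exact ih l' hw _ (hl ▸ hp.cup hi) (.inl (p.cup_arcs_ne_nil i))
    | cap i =>
      obtain ⟨hi, hl⟩ := length_of_cap hs
      rw [hl] at hp
      simp only [FlatState.addCircle_cap]
      exact ih l' hw _ (hp.cap hi) (hp.cap_nonempty hi)
    | cross i e =>
      obtain ⟨hl, n, hi, hn⟩ := length_of_cross hs
      have h1 := ih l' hw p (hl ▸ hp) h
      have h2 := ih l' hw ((p.cap i).cup i)
        (by rw [hl, hn]; rw [hn] at hp; exact (hp.cap hi).cup hi)
        (.inl ((p.cap i).cup_arcs_ne_nil i))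
      simp only [FlatState.addCircle_cap, FlatState.addCircle_cup, h1, h2]
      split_ifs <;> ring

/-- Linear relations between state sums persist when the same slices are put below. -/
theorem stateSum_append_congr {w₁ w₂ w₃ : List Slice} {l : List Bool} {α β : ℤ[T;T⁻¹]}
    (h : ∀ p : FlatState, p.Fits l.length →
      stateSum w₁ l p = α * stateSum w₂ l p + β * stateSum w₃ l p)
    (u : List Slice) (l₀ : List Bool) (hu : strandsAbove u l₀ = some l)
    (p : FlatState) (hp : p.Fits l₀.length) :
    stateSum (u ++ w₁) l₀ p = α * stateSum (u ++ w₂) l₀ p + β * stateSum (u ++ w₃) l₀ p := by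
  induction u generalizing l₀ p with
  | nil =>
    simp only [strandsAbove, Option.some.injEq] at hu
    subst hu
    exact h p hp
  | cons s u ih =>
    simp only [strandsAbove] at hu
    rcases hs : s.step l₀ with _ | l'
    · simp [hs] at hu
    simp only [hs, Option.bind_some] at hu
    simp only [List.cons_append]
    rw [stateSum, stateSum, stateSum, hs]
    cases s with
    | cup i b =>
      obtain ⟨hi, hl⟩ := length_of_cup hs
      exact ih l' hu _ (hl ▸ hp.cup hi)
    | cap i =>
      obtain ⟨hi, hl⟩ := length_of_cap hs
      rw [hl] at hp
      exact ih l' hu _ (hp.cap hi)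
    | cross i e =>
      obtain ⟨hl, n, hi, hn⟩ := length_of_cross hs
      have h1 := ih l' hu p (hl ▸ hp)
      have h2 := ih l' hu ((p.cap i).cup i)
        (by rw [hl, hn]; rw [hn] at hp; exact (hp.cap hi).cup hi)
      simp only [h1, h2]
      split_ifs <;> ring

section Twist

variable {a b c : Bool} {r : List Bool} {w : List Slice}

/-- A crossing of the module acts as `-t⁻¹ + t^(-1/2) U`, where `U` is the turnback. -/
theorem stateSum_cross_antiparallel (p : FlatState) :
    stateSum (.cross 2 false :: w) (a :: b :: c :: (!c) :: r) p =
      -T (-2) * stateSum w (a :: b :: (!c) :: c :: r) p +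
        T (-1) * stateSum w (a :: b :: (!c) :: c :: r) ((p.cap 2).cup 2) := by
  rw [stateSum]
  cases c <;>
    simp [Slice.step, parallelAt, isPositive, orientedWeight, disorientedWeight]

theorem stateSum_turnback (p : FlatState) :
    stateSum (.cap 2 :: .cup 2 c :: w) (a :: b :: c :: (!c) :: r) p =
      stateSum w (a :: b :: c :: (!c) :: r) ((p.cap 2).cup 2) := by
  rw [stateSum]
  cases c <;> simp [Slice.step, stateSum]

/-- A left-handed full twist of two antiparallel strands acts as `t⁻² + (t^(-1/2) - t^(-3/2)) U`,
where `U` is the turnback. -/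
theorem stateSum_twist (hw : strandsAbove w (a :: b :: c :: (!c) :: r) = some [])
    (p : FlatState) (hp : p.Fits (a :: b :: c :: (!c) :: r).length) :
    stateSum (.cross 2 false :: .cross 2 false :: w) (a :: b :: c :: (!c) :: r) p =
      T (-4) * stateSum w (a :: b :: c :: (!c) :: r) p +
        (T (-1) - T (-3)) * stateSum w (a :: b :: c :: (!c) :: r) ((p.cap 2).cup 2) := by
  have hp' : p.Fits (r.length + 2 + 2) := hp
  have hcap := hp'.cap (i := 2) (by omega)
  have hsq : (((p.cap 2).cup 2).cap 2).cup 2 = ((p.cap 2).cup 2).addCircle := by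
    rw [FlatState.cap_cup _ (by rw [hcap.length_eq]; omega), FlatState.addCircle_cup]
  have hcross (q : FlatState) := stateSum_cross_antiparallel (a := a) (b := b) (c := !c) (r := r)
    (w := w) q
  rw [Bool.not_not] at hcross
  rw [stateSum_cross_antiparallel, hcross, hcross, hsq,
    stateSum_addCircle w _ hw _ (hcap.cup (by omega)) (.inl (FlatState.cup_arcs_ne_nil _ _))]
  have e1 : (T (-2) * T (-2) : ℤ[T;T⁻¹]) = T (-4) := by rw [← T_add]; rfl
  have e2 : (T (-2) * T (-1) : ℤ[T;T⁻¹]) = T (-3) := by rw [← T_add]; rfl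
  have e3 : (T (-1) * T (-1) * T 1 : ℤ[T;T⁻¹]) = T (-1) := by rw [← T_add, ← T_add]; rfl
  have e4 : (T (-1) * T (-1) * T (-1) : ℤ[T;T⁻¹]) = T (-3) := by rw [← T_add, ← T_add]; rfl
  linear_combination stateSum w (a :: b :: c :: (!c) :: r) p * e1 +
    stateSum w (a :: b :: c :: (!c) :: r) ((p.cap 2).cup 2) * (e3 + e4 - 2 * e2)

theorem twistModule_succ (n : ℕ) :
    twistModule (n + 1) = .cross 2 false :: .cross 2 false :: twistModule n := rfl

/-- The curls of a turnback below the twist module can be undone. -/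
theorem stateSum_twistModule_turnback
    (hw : strandsAbove w (a :: b :: c :: (!c) :: r) = some []) (n : ℕ)
    (p : FlatState) (hp : p.Fits (a :: b :: c :: (!c) :: r).length) :
    stateSum (twistModule n ++ w) (a :: b :: c :: (!c) :: r) ((p.cap 2).cup 2) =
      stateSum w (a :: b :: c :: (!c) :: r) ((p.cap 2).cup 2) := by
  induction n with
  | zero => rfl
  | succ n ih =>
    have hw' : strandsAbove (twistModule n ++ w) (a :: b :: c :: (!c) :: r) = some [] := by
      rw [strandsAbove_append, strandsAbove_twistModule]
      exact hw
    have hp' : p.Fits (r.length + 2 + 2) := hp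
    have hcap := hp'.cap (i := 2) (by omega)
    have hcup := hcap.cup (i := 2) (by omega)
    rw [twistModule_succ, List.cons_append, List.cons_append, stateSum_twist hw' _ hcup,
      FlatState.cap_cup _ (by rw [hcap.length_eq]; omega), FlatState.addCircle_cup,
      stateSum_addCircle _ _ hw' _ hcup (.inl (FlatState.cup_arcs_ne_nil _ _)), ih]
    have e1 : (T (-1) * T 1 : ℤ[T;T⁻¹]) = 1 := by rw [← T_add]; exact T_zero
    have e2 : (T (-1) * T (-1) : ℤ[T;T⁻¹]) = T (-2) := by rw [← T_add]; rfl
    have e3 : (T (-3) * T 1 : ℤ[T;T⁻¹]) = T (-2) := by rw [← T_add]; rfl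
    have e4 : (T (-3) * T (-1) : ℤ[T;T⁻¹]) = T (-4) := by rw [← T_add]; rfl
    linear_combination stateSum w (a :: b :: c :: (!c) :: r) ((p.cap 2).cup 2) *
      (e1 + e2 - e3 - e4)

end Twist

/-- The part of the diagram of `L_n` below the twist module. -/
def belowModule : List Slice := [.cup 0 true, .cup 1 false, .cup 2 false] ++ fullLeftTwist

/-- The part of the diagram of `L_n` above the twist module. -/
def aboveModule : List Slice :=
  [.cup 5 true, .cross 4 true, .cross 6 true, .cap 5, .cross 3 true, .cap 2, .cap 1, .cap 0]

theorem strandsAbove_belowModule :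
    strandsAbove belowModule [] = some [true, false, false, true, true, false] := by decide

theorem strandsAbove_aboveModule :
    strandsAbove aboveModule [true, false, false, true, true, false] = some [] := by decide

/-- The link `M` obtained from `L_n` by replacing the twist module by its turnback smoothing. -/
def turnbackLink : LinkDiagram where
  slices := belowModule ++ ([.cap 2, .cup 2 false] ++ aboveModule)
  nonempty := by simp [belowModule]
  closed := by
    rw [strandsAbove_append, strandsAbove_belowModule]
    decide

/-- The skein-theoretic recursion for the Jones polynomials of the knots `L_n`. -/
theorem jones_L_succ (n : ℕ) :
    jones (L (n + 1)) = T (-4) * jones (L n) + (T (-1) - T (-3)) * jones turnbackLink := by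
  have hL (m : ℕ) : (L m).slices = belowModule ++ (twistModule m ++ aboveModule) := by
    simp [L, twistKnotSlices, belowModule, aboveModule]
  rw [jones, jones, jones, hL, hL]
  refine stateSum_append_congr (fun p hp => ?_) belowModule [] strandsAbove_belowModule _
    (FlatState.fits_empty 0)
  have hw : strandsAbove (twistModule n ++ aboveModule) [true, false, false, true, true, false] =
      some [] := by
    rw [strandsAbove_append, strandsAbove_twistModule]
    exact strandsAbove_aboveModule
  have h := stateSum_twist (c := false) hw p hp
  have h' := stateSum_twistModule_turnback (c := false) strandsAbove_aboveModule n p hp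
  have h'' := stateSum_turnback (a := true) (b := false) (c := false) (r := [true, false])
    (w := aboveModule) p
  simp only [Bool.not_false] at h h' h''
  rw [twistModule_succ, List.cons_append, List.cons_append, h, h', List.cons_append,
    List.cons_append, List.nil_append, h'']

/-! ### Computable state sums -/

/-- A Laurent polynomial given by the list `list` of its coefficients, in increasing order, starting
with the coefficient of `T (-shift)`. Zeros at the ends of the list are allowed, so this is not a
unique representation. -/
structure Coeffs where
  shift : ℕ
  list : List ℤ
deriving DecidableEq

namespace Coeffs

/-- The polynomial with the given list of coefficients, starting with the constant one. -/
noncomputable def ofList : List ℤ → ℤ[T;T⁻¹]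
  | [] => 0
  | a :: as => C a + T 1 * ofList as

/-- The Laurent polynomial that is represented. -/
noncomputable def value (x : Coeffs) : ℤ[T;T⁻¹] := T (-x.shift) * ofList x.list

/-- Entrywise sum of two lists, the shorter one being extended by zeros. -/
def addList : List ℤ → List ℤ → List ℤ
  | [], bs => bs
  | as, [] => as
  | a :: as, b :: bs => (a + b) :: addList as bs

def add (x y : Coeffs) : Coeffs :=
  if x.shift ≤ y.shift then
    ⟨y.shift, addList (List.replicate (y.shift - x.shift) 0 ++ x.list) y.list⟩
  else ⟨x.shift, addList x.list (List.replicate (x.shift - y.shift) 0 ++ y.list)⟩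

/-- Multiplication by `T 1`. -/
def mulVar (x : Coeffs) : Coeffs := ⟨x.shift, 0 :: x.list⟩

/-- Multiplication by `T (-1)`. -/
def divVar (x : Coeffs) : Coeffs := ⟨x.shift + 1, x.list⟩

def neg (x : Coeffs) : Coeffs := ⟨x.shift, x.list.map fun a => -a⟩

/-- The powers of `T 1 + T (-1)`. -/
def circlePow : ℕ → Coeffs
  | 0 => ⟨0, [1]⟩
  | n + 1 => (circlePow n).mulVar.add (circlePow n).divVar

/-- Multiplication by `orientedWeight`. -/
def oriented (positive : Bool) (x : Coeffs) : Coeffs := if positive then x.divVar else x.mulVar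

/-- Multiplication by `disorientedWeight`. -/
def disoriented (positive : Bool) (x : Coeffs) : Coeffs :=
  if positive then x.divVar.divVar.neg else x.mulVar.mulVar.neg

theorem ofList_addList (as bs : List ℤ) : ofList (addList as bs) = ofList as + ofList bs := by
  induction as generalizing bs with
  | nil => simp [addList, ofList]
  | cons a as ih =>
    cases bs with
    | nil => simp [addList, ofList]
    | cons b bs =>
      simp only [addList, ofList, ih, map_add]
      ring

theorem ofList_replicate_append (k : ℕ) (as : List ℤ) :
    ofList (List.replicate k 0 ++ as) = T k * ofList as := by
  induction k with
  | zero => simp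
  | succ k ih =>
    rw [List.replicate_succ, List.cons_append, ofList, ih, Nat.cast_succ, T_add]
    simp only [map_zero]
    ring

theorem ofList_neg (as : List ℤ) : ofList (as.map fun a => -a) = -ofList as := by
  induction as with
  | nil => simp [ofList]
  | cons a as ih =>
    simp only [List.map_cons, ofList, ih, map_neg]
    ring

theorem value_add (x y : Coeffs) : (x.add y).value = x.value + y.value := by
  have key (m n : ℕ) (h : m ≤ n) : (T (-(n : ℤ)) * T ((n - m : ℕ) : ℤ) : ℤ[T;T⁻¹]) =
      T (-(m : ℤ)) := by
    rw [← T_add]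
    congr 1
    omega
  rw [add]
  split_ifs with h
  · simp only [value, ofList_addList, ofList_replicate_append, ← key _ _ h]
    ring
  · simp only [value, ofList_addList, ofList_replicate_append, ← key _ _ (not_le.1 h).le]
    ring

theorem value_mulVar (x : Coeffs) : x.mulVar.value = T 1 * x.value := by
  simp only [value, mulVar, ofList, map_zero]
  ring

theorem value_divVar (x : Coeffs) : x.divVar.value = T (-1) * x.value := by
  simp only [value, divVar, Nat.cast_succ, neg_add, T_add]
  ring

theorem value_neg (x : Coeffs) : x.neg.value = -x.value := by
  simp only [value, neg, ofList_neg]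
  ring

theorem value_circlePow (n : ℕ) : (circlePow n).value = (T 1 + T (-1)) ^ n := by
  induction n with
  | zero => simp [circlePow, value, ofList]
  | succ n ih =>
    rw [circlePow, value_add, value_mulVar, value_divVar, ih, pow_succ]
    ring

theorem value_oriented (b : Bool) (x : Coeffs) :
    (x.oriented b).value = orientedWeight b * x.value := by
  cases b <;> simp [oriented, orientedWeight, value_mulVar, value_divVar]

theorem value_disoriented (b : Bool) (x : Coeffs) :
    (x.disoriented b).value = disorientedWeight b * x.value := by
  have e1 : (T (-2) : ℤ[T;T⁻¹]) = T (-1) * T (-1) := by rw [← T_add]; rfl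
  have e2 : (T 2 : ℤ[T;T⁻¹]) = T 1 * T 1 := by rw [← T_add]; rfl
  cases b <;>
    simp [disoriented, disorientedWeight, value_mulVar, value_divVar, value_neg, e1, e2, mul_assoc]

end Coeffs

/-- The state sum, computed with lists of coefficients. -/
def stateCoeffs : List Slice → List Bool → FlatState → Coeffs
  | [], _, p => Coeffs.circlePow (p.circles - 1)
  | s :: w, l, p =>
    match s.step l with
    | none => ⟨0, []⟩
    | some l' =>
      match s with
      | .cup i _ => stateCoeffs w l' (p.cup i)
      | .cap i => stateCoeffs w l' (p.cap i)
      | .cross i e =>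
        if parallelAt i l then
          ((stateCoeffs w l' p).oriented (isPositive i e l)).add
            ((stateCoeffs w l' ((p.cap i).cup i)).disoriented (isPositive i e l))
        else
          ((stateCoeffs w l' p).disoriented (isPositive i e l)).add
            ((stateCoeffs w l' ((p.cap i).cup i)).oriented (isPositive i e l))

theorem value_stateCoeffs (w : List Slice) (l : List Bool) (p : FlatState) :
    (stateCoeffs w l p).value = stateSum w l p := by
  induction w generalizing l p with
  | nil => simp [stateCoeffs, stateSum, Coeffs.value_circlePow]
  | cons s w ih =>
    rw [stateCoeffs, stateSum]
    rcases s.step l with _ | l'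
    · simp [Coeffs.value, Coeffs.ofList]
    · cases s with
      | cup i b => exact ih _ _
      | cap i => exact ih _ _
      | cross i e =>
        simp only []
        split_ifs <;>
          simp [Coeffs.value_add, Coeffs.value_oriented, Coeffs.value_disoriented, ih]

theorem jones_eq_value (D : LinkDiagram) : jones D = (stateCoeffs D.slices [] ⟨[], 0⟩).value :=
  (value_stateCoeffs _ _ _).symm

theorem jones_L_zero : jones (L 0) =
    Coeffs.value ⟨16, [0, 0, 0, 0, -1, 0, 1, 0, -1, 0, 2, 0, -1, 0, 1]⟩ := by
  rw [jones_eq_value]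
  exact congrArg Coeffs.value (by decide +kernel)

theorem jones_turnbackLink : jones turnbackLink =
    Coeffs.value ⟨16, [0, 0, 0, 0, 0, -1, 0, 1, 0, -1, 0, 2, 0, -1, 0, 2]⟩ := by
  rw [jones_eq_value]
  exact congrArg Coeffs.value (by decide +kernel)

/-! ### Derivatives at `t = 1` -/

/-- The value of a Laurent polynomial in `t^(1/2)` at `t = e^h`. -/
noncomputable def expEval (P : ℤ[T;T⁻¹]) (h : ℝ) : ℝ :=
  LaurentPolynomial.eval₂ (Int.castRingHom ℝ)
    (Units.mk0 (√(Real.exp h)) (Real.sqrt_pos.2 (Real.exp_pos h)).ne') P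

theorem expEval_add (P Q : ℤ[T;T⁻¹]) : expEval (P + Q) = expEval P + expEval Q := by
  ext h
  simp [expEval]

theorem expEval_C_mul_T (a m : ℤ) :
    expEval (C a * T m) = fun h => (a : ℝ) * Real.exp ((m / 2 : ℝ) * h) := by
  ext h
  rw [expEval, eval₂_C_mul_T, Units.val_zpow_eq_zpow_val, Units.val_mk0, ← Real.exp_half,
    show (m / 2 : ℝ) * h = h / 2 * m by ring, Real.exp_mul, Real.rpow_intCast, eq_intCast]

theorem contDiff_expEval (P : ℤ[T;T⁻¹]) {n : WithTop ℕ∞} : ContDiff ℝ n (expEval P) := by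
  induction P using LaurentPolynomial.induction_on' with
  | add P Q hP hQ =>
    rw [expEval_add]
    exact hP.add hQ
  | C_mul_T m a =>
    rw [expEval_C_mul_T]
    fun_prop

/-- The `k`-th derivative of `h ↦ P(e^(h/2))` at `0`. If `P` has the coefficients `aₘ`, it is the
moment `∑ aₘ (m/2)^k`. -/
noncomputable def moment (k : ℕ) : ℤ[T;T⁻¹] →+ ℝ :=
  AddMonoidHom.mk' (fun P => iteratedDeriv k (expEval P) 0) fun P Q => by
    rw [expEval_add]
    exact iteratedDeriv_add (contDiff_expEval P).contDiffAt (contDiff_expEval Q).contDiffAt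

theorem moment_C_mul_T (k : ℕ) (a m : ℤ) : moment k (C a * T m) = a * (m / 2 : ℝ) ^ k := by
  change iteratedDeriv k (expEval (C a * T m)) 0 = _
  rw [expEval_C_mul_T, iteratedDeriv_const_mul_field]
  simp [iteratedDeriv_exp_const_mul]

/-- The binomial formula for the moments of a multiple by `t^(m/2)`. -/
theorem moment_T_mul (k : ℕ) (m : ℤ) (P : ℤ[T;T⁻¹]) :
    moment k (T m * P) =
      ∑ j ∈ Finset.range (k + 1), (m / 2 : ℝ) ^ j * moment (k - j) P * k.choose j := by
  induction P using LaurentPolynomial.induction_on' with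
  | add P Q hP hQ =>
    simp only [mul_add, map_add, hP, hQ, add_mul, Finset.sum_add_distrib]
  | C_mul_T n a =>
    have : (T m * (C a * T n) : ℤ[T;T⁻¹]) = C a * T (m + n) := by rw [T_add]; ring
    rw [this]
    simp only [moment_C_mul_T]
    push_cast
    rw [add_div, add_pow, Finset.mul_sum]
    exact Finset.sum_congr rfl fun j _ => by ring

theorem moment_T_mul_ofList_cons (k : ℕ) (m a : ℤ) (as : List ℤ) :
    moment k (T m * Coeffs.ofList (a :: as)) =
      a * (m / 2 : ℝ) ^ k + moment k (T (m + 1) * Coeffs.ofList as) := by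
  rw [← moment_C_mul_T, ← map_add, Coeffs.ofList, T_add]
  congr 1
  ring

theorem moment_T_mul_ofList_nil (k : ℕ) (m : ℤ) : moment k (T m * Coeffs.ofList []) = 0 := by
  simp [Coeffs.ofList]

theorem moments_jones_turnbackLink :
    moment 0 (jones turnbackLink) = 2 ∧ moment 1 (jones turnbackLink) = 0 ∧
      moment 2 (jones turnbackLink) = -23 / 2 := by
  rw [jones_turnbackLink, Coeffs.value]
  simp only [moment_T_mul_ofList_cons, moment_T_mul_ofList_nil]
  norm_num

theorem moments_jones_L (n : ℕ) :
    moment 0 (jones (L n)) = 1 ∧ moment 1 (jones (L n)) = 0 ∧ moment 2 (jones (L n)) = -12 ∧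
      moment 3 (jones (L n)) = 36 * n + 108 := by
  induction n with
  | zero =>
    rw [jones_L_zero, Coeffs.value]
    simp only [moment_T_mul_ofList_cons, moment_T_mul_ofList_nil]
    norm_num
  | succ n ih =>
    obtain ⟨h0, h1, h2, h3⟩ := ih
    obtain ⟨g0, g1, g2⟩ := moments_jones_turnbackLink
    simp only [jones_L_succ, sub_mul, map_add, map_sub, moment_T_mul, Finset.sum_range_succ,
      Finset.sum_range_zero, h0, h1, h2, h3, g0, g1, g2]
    norm_num [Nat.choose]
    ring

end KnotDiagram

theorem lemma6p3 (n : ℕ) :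
    iteratedDeriv 2
        (fun h : ℝ => KnotDiagram.jonesAt (KnotDiagram.L n) (Real.exp h) (Real.exp_pos h)) 0
      = -12 ∧
    iteratedDeriv 3
        (fun h : ℝ => KnotDiagram.jonesAt (KnotDiagram.L n) (Real.exp h) (Real.exp_pos h)) 0
      = 36 * (n : ℝ) + 108 := by
  obtain ⟨-, -, h2, h3⟩ := KnotDiagram.moments_jones_L n
  exact ⟨h2, h3⟩
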